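/- Let $n\ge 0$. A generator system in $\mathbb R^n$ is a quadruple $\mathcal G=\langle L,R,C,P\rangle$ of finite subsets of $\mathbb R^n$ (lines, rays, closure points, points) with $0\notin L\cup R$. It generates the (not necessarily closed) polyhedron $$\mathrm{gen}(\mathcal G)=\Bigl\{\sum_{l\in L}\lambda_l l+\sum_{r\in R}\rho_r r+\sum_{c\in C}\gamma_c c+\sum_{p\in P}\pi_p p \Bigm| \lambda_l\in\mathbb R,\ \rho_r,\gamma_c,\pi_p\ge 0,\ \pi\ne 0,\ \sum_{c}\gamma_c+\sum_{p}\pi_p=1\Bigr\}.$$ Put $\mathrm{full.gen}(\langle L,R,C,P\rangle)=\mathrm{gen}(\langle L,R,\emptyset,C\cup P\rangle)$. Inclusion of generator systems is component-wise, and $\mathcal G$ is in minimal form if no proper subsystem of $\mathcal G$ generates $\mathrm{gen}(\mathcal G)$. The skeleton of a system $\langle L,R,C,P\rangle$ in minimal form is $\langle L,R,C\cup SP,\emptyset\rangle$, where $SP$ is the set of all $p\in P$ with $p\notin\mathrm{full.gen}(\langle L,R,C,P\setminus\{p\}\rangle)$. A face of a closed polyhedron $Q$ is a set $\{x\in Q\mid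 a^{\mathrm T}x=b\}$, where $a\in\mathbb R^n$ (possibly $a=0$) and $b\in\mathbb R$ are such that $a^{\mathrm T}x\ge b$ for all $x\in Q$; in particular $\emptyset$ and $Q$ are faces of $Q$. A vector $r\neq 0$ is a ray of a set $F$ if $F\ne\emptyset$ and $p+\rho r\in F$ for all $p\in F$, $\rho\ge 0$, and it is a line of $F$ if both $r$ and $-r$ are rays of $F$. For a skeleton $\mathcal{SK}=\langle L,R,C',\emptyset\rangle$ and a face $F$ of $\mathrm{full.gen}(\mathcal{SK})$, the support $\mathcal{SK}_F\subseteq\mathcal{SK}$ consists of the elements of $L$ that are lines of $F$, the elements of $R$ that are rays of $F$ and the elements of $C'\cap F$. Let $\mathbb{NS}$ be the set of all these supports, and for a support $ns$ let $\uparrow ns=\{ns'\in\mathbb{NS}\mid ns\subseteq ns'\}$. For $\mathcal{SK}$ a skeleton of a polyhedron with topological closure $Q$, for $S\subseteq Q$ and for $NS\subseteq\mathbb{NS}$ upward closed, define $$\alpha_{\mathcal{SK}}(S)=\bigcup\{\uparrow\mathcal{SK}_F\mid F\text{ a face of }Q,\ S\cap\mathrm{relint}(F)\ne\emptyset\},\qquad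 \gamma_{\mathcal{SK}}(NS)=\bigcup_{ns\in NS}\mathrm{relint}(\mathrm{full.gen}(ns)).$$ **Proposition.** Let $\mathcal G=\langle L,R,C,P\rangle$ be a generator system, $\mathcal P=\mathrm{gen}(\mathcal G)$, $Q=\mathrm{cl}(\mathcal P)$, and let $\mathcal{SK}$ be the skeleton of any generator system in minimal form that generates $\mathcal P$ (for instance of $\mathcal G$ itself, if $\mathcal G$ is in minimal form). Then $$\mathcal P=(\gamma_{\mathcal{SK}}\circ\alpha_{\mathcal{SK}})(P).$$ Moreover, $\mathcal P$ is the union of the sets $\mathrm{relint}(F)$ over all faces $F$ of $Q$ such that $\mathcal{SK}_{F'}\subseteq\mathcal{SK}_F$ for some face $F'$ of $Q$ with $P\cap\mathrm{relint}(F')\neq\emptyset$. -/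

import Mathlib

/-- A generator system `⟨L, R, C, P⟩` in `ℝⁿ`: finite sets of lines, rays, closure points
and points, where lines and rays are non-zero vectors. -/
@[ext]
structure GenSystem (n : ℕ) where
  /-- the lines `L` -/
  lines : Finset (EuclideanSpace ℝ (Fin n))
  /-- the rays `R` -/
  rays : Finset (EuclideanSpace ℝ (Fin n))
  /-- the closure points `C` -/
  closurePoints : Finset (EuclideanSpace ℝ (Fin n))
  /-- the points `P` -/
  points : Finset (EuclideanSpace ℝ (Fin n))
  zero_notMem_lines : (0 : EuclideanSpace ℝ (Fin n)) ∉ lines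
  zero_notMem_rays : (0 : EuclideanSpace ℝ (Fin n)) ∉ rays

namespace GenSystem

variable {n : ℕ}

/-- Component-wise inclusion of generator systems. -/
instance : HasSubset (GenSystem n) where
  Subset G G' := G.lines ⊆ G'.lines ∧ G.rays ⊆ G'.rays ∧
    G.closurePoints ⊆ G'.closurePoints ∧ G.points ⊆ G'.points

/-- The NNC polyhedron `gen(⟨L, R, C, P⟩)`: all `Lλ + Rρ + Cγ + Pπ` with `λ` arbitrary,
`ρ, γ, π ≥ 0`, `π ≠ 0` and `∑ γ + ∑ π = 1`. -/
def gen (G : GenSystem n) : Set (EuclideanSpace ℝ (Fin n)) :=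
  {x | ∃ l r c p : EuclideanSpace ℝ (Fin n) → ℝ,
    (∀ v ∈ G.rays, 0 ≤ r v) ∧ (∀ v ∈ G.closurePoints, 0 ≤ c v) ∧
    (∀ v ∈ G.points, 0 ≤ p v) ∧ (∃ v ∈ G.points, p v ≠ 0) ∧
    (∑ v ∈ G.closurePoints, c v) + (∑ v ∈ G.points, p v) = 1 ∧
    x = (∑ v ∈ G.lines, l v • v) + (∑ v ∈ G.rays, r v • v) +
      (∑ v ∈ G.closurePoints, c v • v) + (∑ v ∈ G.points, p v • v)}

open Classical in
/-- The system `⟨L, R, ∅, C ∪ P⟩`, in which closure points are reinterpreted as points. -/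
noncomputable def full (G : GenSystem n) : GenSystem n where
  lines := G.lines
  rays := G.rays
  closurePoints := ∅
  points := G.closurePoints ∪ G.points
  zero_notMem_lines := G.zero_notMem_lines
  zero_notMem_rays := G.zero_notMem_rays

/-- `full.gen(⟨L, R, C, P⟩) = gen(⟨L, R, ∅, C ∪ P⟩)`. -/
def fullGen (G : GenSystem n) : Set (EuclideanSpace ℝ (Fin n)) := G.full.gen

/-- `G` is in minimal form: it has no redundant element, that is, no proper subsystem of `G`
generates the same polyhedron. -/
def IsMinimalForm (G : GenSystem n) : Prop :=
  ∀ G' : GenSystem n, G' ⊆ G → G'.gen = G.gen → G' = G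

open Classical in
/-- The system `⟨L, R, C, P \ {p}⟩`. -/
noncomputable def erasePoint (G : GenSystem n) (p : EuclideanSpace ℝ (Fin n)) :
    GenSystem n where
  lines := G.lines
  rays := G.rays
  closurePoints := G.closurePoints
  points := G.points.erase p
  zero_notMem_lines := G.zero_notMem_lines
  zero_notMem_rays := G.zero_notMem_rays

open Classical in
/-- The skeleton points `SP ⊆ P`: the points that cannot be obtained as a combination of the
other generators (where closure points may be used just like points). -/
noncomputable def skelPoints (G : GenSystem n) : Finset (EuclideanSpace ℝ (Fin n)) :=
  G.points.filter fun p => p ∉ (G.erasePoint p).fullGen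

open Classical in
/-- The skeleton `skel(⟨L, R, C, P⟩) = ⟨L, R, C ∪ SP, ∅⟩`. -/
noncomputable def skel (G : GenSystem n) : GenSystem n where
  lines := G.lines
  rays := G.rays
  closurePoints := G.closurePoints ∪ G.skelPoints
  points := ∅
  zero_notMem_lines := G.zero_notMem_lines
  zero_notMem_rays := G.zero_notMem_rays

end GenSystem

namespace NNC

variable {n : ℕ}

/-- `r` is a ray of `S`; the empty set has no rays. -/
def IsRay (S : Set (EuclideanSpace ℝ (Fin n))) (r : EuclideanSpace ℝ (Fin n)) : Prop :=
  S.Nonempty ∧ r ≠ 0 ∧ ∀ p ∈ S, ∀ t : ℝ, 0 ≤ t → p + t • r ∈ S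

/-- `l` is a line of `S`: both `l` and `-l` are rays of `S`. -/
def IsLine (S : Set (EuclideanSpace ℝ (Fin n))) (l : EuclideanSpace ℝ (Fin n)) : Prop :=
  IsRay S l ∧ IsRay S (-l)

/-- The faces of a closed polyhedron `Q`: the sets `{x ∈ Q | aᵀx = b}`, where `aᵀx ≥ b` is
valid for `Q`. The trivial constraints (`a = 0`) are allowed, so that `Q` and the empty set
are always faces, see `self_mem_cFaces` and `empty_mem_cFaces`. -/
def cFaces (Q : Set (EuclideanSpace ℝ (Fin n))) : Set (Set (EuclideanSpace ℝ (Fin n))) :=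
  {F | ∃ (a : EuclideanSpace ℝ (Fin n)) (b : ℝ),
    (∀ x ∈ Q, b ≤ inner ℝ a x) ∧ F = {x ∈ Q | inner ℝ a x = b}}

theorem self_mem_cFaces (Q : Set (EuclideanSpace ℝ (Fin n))) : Q ∈ cFaces Q :=
  ⟨0, 0, by simp, by simp⟩

theorem empty_mem_cFaces (Q : Set (EuclideanSpace ℝ (Fin n))) : ∅ ∈ cFaces Q :=
  ⟨0, -1, by simp, by simp⟩

open Classical in
/-- The support `SK_F ⊆ SK` of a face `F`: the subsystem of all elements of the skeleton that
are included in `F` (as lines, as rays, or as points, respectively). -/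
noncomputable def support (SK : GenSystem n) (F : Set (EuclideanSpace ℝ (Fin n))) :
    GenSystem n where
  lines := SK.lines.filter fun l => IsLine F l
  rays := SK.rays.filter fun r => IsRay F r
  closurePoints := SK.closurePoints.filter fun c => c ∈ F
  points := ∅
  zero_notMem_lines := fun h => SK.zero_notMem_lines (Finset.mem_filter.1 h).1
  zero_notMem_rays := fun h => SK.zero_notMem_rays (Finset.mem_filter.1 h).1

/-- The set `NS_SK` of all supports for `SK`. -/
def supports (SK : GenSystem n) : Set (GenSystem n) :=
  {ns | ∃ F ∈ cFaces SK.fullGen, ns = support SK F}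

/-- The upward closure `↑ns` in the set of all supports for `SK`. -/
def up (SK ns : GenSystem n) : Set (GenSystem n) :=
  {ns' | ns' ∈ supports SK ∧ ns ⊆ ns'}

/-- The abstraction function `α_SK`, where `SK` is the skeleton of a polyhedron with
topological closure `Q`: the union of all `↑SK_F` such that `F` is a face of `Q` whose relative
interior contains a point of `S`. -/
def alpha (SK : GenSystem n) (Q S : Set (EuclideanSpace ℝ (Fin n))) : Set (GenSystem n) :=
  ⋃₀ {U | ∃ p ∈ S, ∃ F ∈ cFaces Q, p ∈ intrinsicInterior ℝ F ∧ U = up SK (support SK F)}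

/-- The concretization function `γ_SK`: the union of the relative interiors of the
`full.gen(ns)`, for `ns ∈ NS`. -/
def gamma (NS : Set (GenSystem n)) : Set (EuclideanSpace ℝ (Fin n)) :=
  ⋃ ns ∈ NS, intrinsicInterior ℝ ns.fullGen

end NNC

/-! Write `Q` for the closure of `G.gen`. If `G` has a point, `Q` is `G.fullGen`, since every
segment from a point of `G.fullGen` to a point of `G` lies in `G.gen` apart from possibly its first
end. Minimal form is needed only to show that the skeleton generates the same `Q` (`fullGen_skel`).

By Weyl's theorem `Q` is cut out by finitely many half-spaces, so each of its elements lies in the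
relative interior of some face: add up the constraints tight at it. The generators of the skeleton
that lie in a face `F` generate exactly `F` (`fullGen_support`). Hence inclusion of supports is the
same as inclusion of faces, and for `p` in the relative interior of `F'` it says precisely that `p ∈
F`.

It remains to see that `G.gen` is the union of the relative interiors of the faces containing a
point of `G` (`gen_eq_iUnion_intrinsicInterior`). An element `x` of `G.gen` gives positive weight to
some point `p`, so `x` can be pushed slightly away from `p` inside `Q`, and every face containing
`x` contains `p`. Conversely, if `p ∈ F` and `x` is in the relative interior of `F`, then `x` can be
pushed away from `p` to some `y ∈ F`; so `x` is a combination of `y` and `p` with positive weight on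
`p`, hence lies in `G.gen`. -/

/-! ### Finitely generated cones: Weyl's theorem by Fourier–Motzkin elimination. -/

section Cone

variable {V : Type*} [AddCommGroup V] [Module ℝ V]

/-- Fourier–Motzkin elimination: adding one generator to a cone cut out by finitely many
linear inequalities yields a cone of the same form. -/
theorem exists_finite_dual_add_smul {T : Set (Module.Dual ℝ V)} (hT : T.Finite) (v : V) :
    ∃ T' : Set (Module.Dual ℝ V), T'.Finite ∧
      ∀ x, (∃ t : ℝ, 0 ≤ t ∧ ∀ f ∈ T, 0 ≤ f (x - t • v)) ↔ ∀ f ∈ T', 0 ≤ f x := by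
  -- The constraint `f` bounds `t` below when `f v < 0` and above when `f v > 0`. The combination of
  -- such a pair vanishes at `v`, so `t` drops out; it says that the lower bound is at most the
  -- upper one. The constraints with `0 ≤ f v` encode compatibility with `0 ≤ t`.
  refine ⟨{f ∈ T | 0 ≤ f v} ∪ Set.image2 (fun f g => -(g v) • f + f v • g)
    {f ∈ T | 0 < f v} {g ∈ T | g v < 0},
    (hT.subset (Set.sep_subset _ _)).union
      ((hT.subset (Set.sep_subset _ _)).image2 _ (hT.subset (Set.sep_subset _ _))),
    fun x => ⟨?_, fun h => ?_⟩⟩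
  · rintro ⟨t, ht, h⟩ f (⟨hf, hfv⟩ | ⟨f, ⟨hf, hfv⟩, g, ⟨hg, hgv⟩, rfl⟩)
    · have := h f hf
      simp only [map_sub, map_smul, smul_eq_mul] at this
      nlinarith [mul_nonneg ht hfv]
    · have h1 := h f hf
      have h2 := h g hg
      simp only [map_sub, map_smul, smul_eq_mul] at h1 h2
      simp only [LinearMap.add_apply, LinearMap.smul_apply, smul_eq_mul]
      nlinarith [mul_nonneg h1 (neg_pos.2 hgv).le, mul_nonneg h2 hfv.le]
  · have hpos : ∀ f ∈ T, 0 ≤ f v → 0 ≤ f x := fun f hf hfv => h f (Or.inl ⟨hf, hfv⟩)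
    have hpair : ∀ f ∈ T, 0 < f v → ∀ g ∈ T, g v < 0 → g x / g v ≤ f x / f v := by
      intro f hf hfv g hg hgv
      have := h _ (Or.inr ⟨f, ⟨hf, hfv⟩, g, ⟨hg, hgv⟩, rfl⟩)
      simp only [LinearMap.add_apply, LinearMap.smul_apply, smul_eq_mul] at this
      rw [← neg_div_neg_eq, div_le_div_iff₀ (neg_pos.2 hgv) hfv]
      linarith
    -- the largest of the lower bounds on `t`
    let A : Set ℝ := insert 0 ((fun g : Module.Dual ℝ V => g x / g v) '' {g ∈ T | g v < 0})
    have hA : A.Finite := ((hT.subset (Set.sep_subset _ _)).image _).insert 0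
    obtain ⟨t, htA, htmax⟩ := hA.exists_maximal ⟨0, Set.mem_insert _ _⟩
    have hmax : ∀ s ∈ A, s ≤ t := fun s hs => (le_total s t).elim id fun h' => htmax hs h'
    refine ⟨t, hmax 0 (Set.mem_insert _ _), fun f hf => ?_⟩
    simp only [map_sub, map_smul, smul_eq_mul, sub_nonneg]
    rcases lt_trichotomy (f v) 0 with hfv | hfv | hfv
    · have := hmax (f x / f v) (Or.inr ⟨f, ⟨hf, hfv⟩, rfl⟩)
      rwa [div_le_iff_of_neg hfv] at this
    · simpa [hfv] using hpos f hf hfv.ge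
    · rw [← le_div_iff₀ hfv]
      rcases htA with rfl | ⟨g, ⟨hg, hgv⟩, rfl⟩
      · exact div_nonneg (hpos f hf hfv.le) hfv.le
      · exact hpair f hf hfv g hg hgv

theorem exists_finite_dual_eq_zero [FiniteDimensional ℝ V] :
    ∃ T : Set (Module.Dual ℝ V), T.Finite ∧ ∀ x, x = 0 ↔ ∀ f ∈ T, 0 ≤ f x := by
  let b := Module.finBasis ℝ V
  refine ⟨Set.range b.coord ∪ Set.range fun i => -b.coord i,
    (Set.finite_range _).union (Set.finite_range _), fun x => ⟨by rintro rfl; simp, fun h => ?_⟩⟩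
  refine b.ext_elem fun i => ?_
  have h1 := h _ (Or.inl ⟨i, rfl⟩)
  have h2 := h _ (Or.inr ⟨i, rfl⟩)
  simp only [LinearMap.neg_apply, Module.Basis.coord_apply] at h1 h2
  simp only [map_zero, Finsupp.coe_zero, Pi.zero_apply]
  linarith

/-- Weyl's theorem: a finitely generated cone is cut out by finitely many linear inequalities. -/
theorem exists_finite_dual_sum_smul [FiniteDimensional ℝ V] {ι : Type*} (s : Finset ι)
    (g : ι → V) :
    ∃ T : Set (Module.Dual ℝ V), T.Finite ∧
      ∀ x, (∃ w : ι → ℝ, (∀ i ∈ s, 0 ≤ w i) ∧ x = ∑ i ∈ s, w i • g i) ↔ ∀ f ∈ T, 0 ≤ f x := by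
  classical
  induction s using Finset.induction_on with
  | empty => simpa using exists_finite_dual_eq_zero
  | insert i s hi ih =>
    obtain ⟨T, hT, h⟩ := ih
    obtain ⟨T', hT', h'⟩ := exists_finite_dual_add_smul hT (g i)
    refine ⟨T', hT', fun x => ?_⟩
    rw [← h']
    simp only [← h]
    constructor
    · rintro ⟨w, hw, rfl⟩
      exact ⟨w i, hw i (by simp), w, fun j hj => hw j (by simp [hj]), by simp [hi]⟩
    · rintro ⟨t, ht, w, hw, hx⟩
      have hne : ∀ j ∈ s, j ≠ i := fun j hj h => hi (h ▸ hj)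
      refine ⟨Function.update w i t, fun j hj => ?_, ?_⟩
      · rcases eq_or_ne j i with rfl | hji
        · simpa using ht
        · simpa [hji] using hw j (by simpa [hji] using hj)
      · rw [Finset.sum_insert hi, Function.update_self,
          Finset.sum_congr rfl fun j hj => by rw [Function.update_of_ne (hne j hj)], ← hx]
        abel

end Cone

/-! ### Relative interiors of sets and of faces of polyhedra. -/

section RelativeInterior

variable {E : Type*} [NormedAddCommGroup E] [NormedSpace ℝ E]

/-- From a relative interior point of `F` one can move a little away from any point of `F`. -/
theorem exists_pos_add_smul_sub_mem_of_mem_intrinsicInterior {F : Set E} {x p : E}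
    (hx : x ∈ intrinsicInterior ℝ F) (hp : p ∈ F) : ∃ ε : ℝ, 0 < ε ∧ x + ε • (x - p) ∈ F := by
  obtain ⟨y, hy, rfl⟩ := mem_intrinsicInterior.1 hx
  have hpF : p ∈ affineSpan ℝ F := subset_affineSpan ℝ F hp
  have hmem (t : ℝ) : (y : E) + t • (y - p) ∈ affineSpan ℝ F := by
    have := AffineSubspace.vadd_mem_of_mem_direction
      (Submodule.smul_mem _ t (AffineSubspace.vsub_mem_direction y.2 hpF)) y.2
    simpa [add_comm] using this
  -- The line through `p` and `y` stays in the affine span, so relative openness can be pulled back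
  -- along it to a neighbourhood of `0` in `ℝ`.
  let φ : ℝ → affineSpan ℝ F := fun t => ⟨(y : E) + t • (y - p), hmem t⟩
  have hφ : Continuous φ := by
    refine Continuous.subtype_mk ?_ _
    fun_prop
  have hφ0 : φ 0 = y := by ext; simp [φ]
  have hnhds : φ ⁻¹' interior ((↑) ⁻¹' F) ∈ nhds (0 : ℝ) :=
    (isOpen_interior.preimage hφ).mem_nhds (by simpa [hφ0] using hy)
  obtain ⟨δ, hδ, hball⟩ := Metric.mem_nhds_iff.1 hnhds
  refine ⟨δ / 2, by positivity, ?_⟩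
  have : φ (δ / 2) ∈ interior ((↑) ⁻¹' F) := hball (by
    rw [Metric.mem_ball, Real.dist_eq, sub_zero, abs_of_pos (by positivity)]; linarith)
  exact (interior_subset this : φ (δ / 2) ∈ ((↑) ⁻¹' F : Set (affineSpan ℝ F)))

end RelativeInterior

section Polyhedron

variable {E : Type*} [NormedAddCommGroup E] [InnerProductSpace ℝ E]

/-- A point of a polyhedron lies in the relative interior of the set cut out by turning all
constraints which are tight at it into equations. -/
theorem mem_intrinsicInterior_tight {T : Set (E × ℝ)} (hT : T.Finite) {x : E}
    (hx : ∀ f ∈ T, f.2 ≤ inner ℝ f.1 x) :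
    x ∈ intrinsicInterior ℝ {y | (∀ f ∈ T, f.2 ≤ inner ℝ f.1 y) ∧
      ∀ f ∈ T, inner ℝ f.1 x = f.2 → inner ℝ f.1 y = f.2} := by
  set F : Set E := {y | (∀ f ∈ T, f.2 ≤ inner ℝ f.1 y) ∧
      ∀ f ∈ T, inner ℝ f.1 x = f.2 → inner ℝ f.1 y = f.2} with hF
  have hxF : x ∈ F := ⟨hx, fun _ _ => id⟩
  have hspan : ∀ y ∈ affineSpan ℝ F, ∀ f ∈ T, inner ℝ f.1 x = f.2 → inner ℝ f.1 y = f.2 := by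
    intro y hy f hf hfx
    refine affineSpan_induction (p := fun y => inner ℝ f.1 y = f.2) hy
      (fun y hy => hy.2 f hf hfx) fun c u v w hu hv hw => ?_
    simp [inner_add_right, inner_smul_right, inner_sub_right, hu, hv, hw]
  -- The tight equations persist on the whole affine span of `F`, so within it only the constraints
  -- that are strict at `x` matter, and these define an open set.
  let U : Set E := ⋂ f ∈ {f ∈ T | inner ℝ f.1 x ≠ f.2}, {y | f.2 < inner ℝ f.1 y}
  have hU : IsOpen U := (hT.subset (Set.sep_subset _ _)).isOpen_biInter fun f _ =>
    isOpen_lt continuous_const (by fun_prop)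
  refine mem_intrinsicInterior.2 ⟨⟨x, subset_affineSpan ℝ F hxF⟩, ?_, rfl⟩
  refine mem_interior.2 ⟨(↑) ⁻¹' U, fun y hy => ?_, hU.preimage continuous_subtype_val, ?_⟩
  · simp only [U, Set.mem_preimage, Set.mem_iInter] at hy
    refine ⟨fun f hf => ?_, hspan y y.2⟩
    by_cases hfx : inner ℝ f.1 x = f.2
    · exact (hspan y y.2 f hf hfx).ge
    · exact (hy f ⟨hf, hfx⟩).le
  · simp only [U, Set.mem_preimage, Set.mem_iInter]
    exact fun f hf => lt_of_le_of_ne (hx f hf.1) (Ne.symm hf.2)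

end Polyhedron

/-- Weyl's theorem for polyhedra: a set given by finitely many lines, rays and (two kinds of)
points is cut out by finitely many linear inequalities. -/
theorem exists_finite_halfspaces_of_generators {E : Type*} [NormedAddCommGroup E]
    [InnerProductSpace ℝ E] [FiniteDimensional ℝ E] (L R C P : Finset E) :
    ∃ T : Set (E × ℝ), T.Finite ∧ ∀ x, (∃ l r c p : E → ℝ,
      (∀ v ∈ R, 0 ≤ r v) ∧ (∀ v ∈ C, 0 ≤ c v) ∧ (∀ v ∈ P, 0 ≤ p v) ∧
      (∑ v ∈ C, c v) + (∑ v ∈ P, p v) = 1 ∧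
      x = (∑ v ∈ L, l v • v) + (∑ v ∈ R, r v • v) + (∑ v ∈ C, c v • v) + (∑ v ∈ P, p v • v)) ↔
      ∀ f ∈ T, f.2 ≤ inner ℝ f.1 x := by
  -- Homogenization: a line becomes two opposite rays, directions get last coordinate 0 and points
  -- last coordinate 1. Then `x` is generated iff `(x, 1)` lies in the cone, the last coordinate
  -- recording that the weights sum to 1.
  let s : Finset ((E ⊕ E) ⊕ E ⊕ E ⊕ E) :=
    (L.disjSum L).disjSum (R.disjSum (C.disjSum P))
  let g : (E ⊕ E) ⊕ E ⊕ E ⊕ E → E × ℝ :=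
    Sum.elim (Sum.elim (fun v => (v, 0)) (fun v => (-v, 0)))
      (Sum.elim (fun v => (v, 0)) (Sum.elim (fun v => (v, 1)) (fun v => (v, 1))))
  obtain ⟨T, hT, h⟩ := exists_finite_dual_sum_smul s g
  have key (x : E) : (∃ l r c p : E → ℝ,
      (∀ v ∈ R, 0 ≤ r v) ∧ (∀ v ∈ C, 0 ≤ c v) ∧ (∀ v ∈ P, 0 ≤ p v) ∧
      (∑ v ∈ C, c v) + (∑ v ∈ P, p v) = 1 ∧
      x = (∑ v ∈ L, l v • v) + (∑ v ∈ R, r v • v) + (∑ v ∈ C, c v • v) + (∑ v ∈ P, p v • v)) ↔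
      ∃ w : (E ⊕ E) ⊕ E ⊕ E ⊕ E → ℝ, (∀ i ∈ s, 0 ≤ w i) ∧ ((x, 1) : E × ℝ) = ∑ i ∈ s, w i • g i := by
    constructor
    · rintro ⟨l, r, c, p, hr, hc, hp, hsum, rfl⟩
      refine ⟨Sum.elim (Sum.elim (fun v => max (l v) 0) (fun v => max (-l v) 0))
        (Sum.elim r (Sum.elim c p)), ?_, ?_⟩
      · simp only [s, Finset.mem_disjSum]
        rintro i (⟨-, (⟨v, hv, rfl⟩ | ⟨v, hv, rfl⟩), rfl⟩ |
          ⟨-, (⟨v, hv, rfl⟩ | ⟨-, (⟨v, hv, rfl⟩ | ⟨v, hv, rfl⟩), rfl⟩), rfl⟩)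
        exacts [le_max_right _ _, le_max_right _ _, hr v hv, hc v hv, hp v hv]
      · have hl : ∑ v ∈ L, l v • v =
            ∑ v ∈ L, max (l v) 0 • v + -∑ v ∈ L, max (-l v) 0 • v := by
          rw [← sub_eq_add_neg, ← Finset.sum_sub_distrib]
          refine Finset.sum_congr rfl fun v _ => ?_
          rw [← sub_smul, max_zero_sub_max_neg_zero_eq_self]
        ext1
        · simp [s, g, Finset.sum_disjSum, Prod.fst_sum, hl, add_assoc]
        · simp [s, g, Finset.sum_disjSum, Prod.snd_sum, hsum]
    · rintro ⟨w, hw, hx⟩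
      have h1 := congrArg Prod.fst hx
      have h2 := congrArg Prod.snd hx
      simp only [s, g, Finset.sum_disjSum, Sum.elim_inl, Sum.elim_inr, Prod.fst_add,
        Prod.fst_sum, Prod.smul_fst, Prod.snd_add, Prod.snd_sum, Prod.smul_snd, smul_eq_mul,
        mul_zero, mul_one, Finset.sum_const_zero, zero_add] at h1 h2
      simp only [s, Finset.mem_disjSum] at hw
      refine ⟨fun v => w (.inl (.inl v)) - w (.inl (.inr v)), fun v => w (.inr (.inl v)),
        fun v => w (.inr (.inr (.inl v))), fun v => w (.inr (.inr (.inr v))),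
        fun v hv => hw _ (by simp [hv]), fun v hv => hw _ (by simp [hv]),
        fun v hv => hw _ (by simp [hv]), h2.symm, ?_⟩
      rw [h1]
      simp only [sub_smul, Finset.sum_sub_distrib, smul_neg, Finset.sum_neg_distrib]
      abel
  -- Dehomogenization: `0 ≤ f (x, 1)` means `-f (0, 1) ≤ f (x, 0)`, and the linear part is an inner
  -- product by Riesz representation.
  refine ⟨(fun f : Module.Dual ℝ (E × ℝ) => ((InnerProductSpace.toDual ℝ E).symm
    (LinearMap.toContinuousLinearMap (f ∘ₗ LinearMap.inl ℝ E ℝ)), -f (0, 1))) '' T,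
    hT.image _, ?_⟩
  intro x
  rw [key, h, Set.forall_mem_image]
  refine forall₂_congr fun f _ => ?_
  have : f (x, 1) = f (x, 0) + f (0, 1) := by rw [← map_add]; simp
  rw [InnerProductSpace.toDual_symm_apply, this, neg_le_iff_add_nonneg]
  rfl

/-! ### Generator systems: structure of `fullGen`. -/

namespace GenSystem

variable {n : ℕ}

/-- Membership in `G.fullGen` with separate weights for closure points and points. -/
theorem mem_fullGen_iff {G : GenSystem n} {x : EuclideanSpace ℝ (Fin n)} :
    x ∈ G.fullGen ↔ ∃ l r c p : EuclideanSpace ℝ (Fin n) → ℝ,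
      (∀ v ∈ G.rays, 0 ≤ r v) ∧ (∀ v ∈ G.closurePoints, 0 ≤ c v) ∧ (∀ v ∈ G.points, 0 ≤ p v) ∧
      (∑ v ∈ G.closurePoints, c v) + (∑ v ∈ G.points, p v) = 1 ∧
      x = (∑ v ∈ G.lines, l v • v) + (∑ v ∈ G.rays, r v • v) +
        (∑ v ∈ G.closurePoints, c v • v) + (∑ v ∈ G.points, p v • v) := by
  classical
  constructor
  · rintro ⟨l, r, c, p, hr, -, hp, -, hsum, rfl⟩
    have hsplit {M : Type} [AddCommMonoid M] (f : EuclideanSpace ℝ (Fin n) → M) :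
        ∑ v ∈ G.closurePoints ∪ G.points, f v =
          ∑ v ∈ G.closurePoints \ G.points, f v + ∑ v ∈ G.points, f v := by
      rw [← Finset.sdiff_union_self_eq_union, Finset.sum_union Finset.sdiff_disjoint]
    -- A vector that is both a closure point and a point occurs once in the union; all its weight is
    -- assigned to the point.
    refine ⟨l, r, fun v => if v ∈ G.points then 0 else p v, p, hr, fun v hv => ?_, fun v hv =>
      hp v (Finset.mem_union_right _ hv), ?_, ?_⟩
    · dsimp only
      split_ifs
      · exact le_rfl
      · exact hp v (Finset.mem_union_left _ hv)
    · simp only [full, Finset.sum_empty, zero_add] at hsum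
      rw [hsplit] at hsum
      rw [← hsum, Finset.sdiff_eq_filter, Finset.sum_filter]
      simp only [ite_not]
    · simp only [full, Finset.sum_empty, add_zero]
      rw [hsplit, Finset.sdiff_eq_filter, Finset.sum_filter]
      simp only [ite_not, ite_smul, zero_smul, add_assoc]
  · rintro ⟨l, r, c, p, hr, hc, hp, hsum, rfl⟩
    -- On the overlap of closure points and points the two weights add up. That some weight is
    -- non-zero is then automatic, as they sum to 1.
    let w : EuclideanSpace ℝ (Fin n) → ℝ := fun v =>
      (if v ∈ G.closurePoints then c v else 0) + (if v ∈ G.points then p v else 0)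
    have hw : ∀ v, 0 ≤ w v := fun v => by
      refine add_nonneg ?_ ?_ <;> split_ifs with h
      exacts [hc v h, le_rfl, hp v h, le_rfl]
    have hw1 : ∑ v ∈ G.closurePoints ∪ G.points, w v = 1 := by
      rw [← hsum, Finset.sum_add_distrib, Finset.sum_ite_mem, Finset.sum_ite_mem,
        Finset.union_inter_cancel_left, Finset.union_inter_cancel_right]
    refine ⟨l, r, 0, w, hr, fun _ _ => le_rfl, fun v _ => hw v, ?_, ?_, ?_⟩
    · by_contra! h
      have : ∑ v ∈ G.closurePoints ∪ G.points, w v = 0 := Finset.sum_eq_zero h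
      linarith
    · simpa [full] using hw1
    · simp only [full, Finset.sum_empty, add_zero, w, add_smul, ite_smul, zero_smul]
      rw [Finset.sum_add_distrib, Finset.sum_ite_mem, Finset.sum_ite_mem,
        Finset.union_inter_cancel_left, Finset.union_inter_cancel_right]
      simp only [add_assoc]

theorem gen_subset_fullGen (G : GenSystem n) : G.gen ⊆ G.fullGen := by
  rintro x ⟨l, r, c, p, hr, hc, hp, -, h⟩
  exact mem_fullGen_iff.2 ⟨l, r, c, p, hr, hc, hp, h⟩

theorem gen_eq_empty {G : GenSystem n} (h : G.points = ∅) : G.gen = ∅ := by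
  ext x
  simp [gen, h]

/-- A polyhedron given by generators is cut out by finitely many linear inequalities. -/
theorem exists_fullGen_eq_halfspaces (G : GenSystem n) :
    ∃ T : Set (EuclideanSpace ℝ (Fin n) × ℝ), T.Finite ∧
      G.fullGen = {x | ∀ f ∈ T, f.2 ≤ inner ℝ f.1 x} := by
  obtain ⟨T, hT, h⟩ :=
    exists_finite_halfspaces_of_generators G.lines G.rays G.closurePoints G.points
  exact ⟨T, hT, Set.ext fun x => mem_fullGen_iff.trans (h x)⟩

theorem isClosed_fullGen (G : GenSystem n) : IsClosed G.fullGen := by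
  obtain ⟨T, -, h⟩ := G.exists_fullGen_eq_halfspaces
  rw [h]
  simp only [Set.ofPred_forall]
  exact isClosed_biInter fun f _ => isClosed_le continuous_const (by fun_prop)

theorem convex_fullGen (G : GenSystem n) : Convex ℝ G.fullGen := by
  obtain ⟨T, -, h⟩ := G.exists_fullGen_eq_halfspaces
  rw [h]
  simp only [Set.ofPred_forall]
  exact convex_iInter₂ fun f _ => convex_halfSpace_ge (innerₗ _ f.1).isLinear _

theorem add_smul_line_mem_fullGen {G : GenSystem n} {x v : EuclideanSpace ℝ (Fin n)}
    (hx : x ∈ G.fullGen) (hv : v ∈ G.lines) (t : ℝ) : x + t • v ∈ G.fullGen := by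
  classical
  rw [mem_fullGen_iff] at hx ⊢
  obtain ⟨l, r, c, p, hr, hc, hp, hsum, rfl⟩ := hx
  refine ⟨fun u => l u + if u = v then t else 0, r, c, p, hr, hc, hp, hsum, ?_⟩
  simp only [add_smul, Finset.sum_add_distrib, ite_smul, zero_smul, Finset.sum_ite_eq', hv, if_true]
  abel

theorem add_smul_ray_mem_fullGen {G : GenSystem n} {x v : EuclideanSpace ℝ (Fin n)}
    (hx : x ∈ G.fullGen) (hv : v ∈ G.rays) {t : ℝ} (ht : 0 ≤ t) : x + t • v ∈ G.fullGen := by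
  classical
  rw [mem_fullGen_iff] at hx ⊢
  obtain ⟨l, r, c, p, hr, hc, hp, hsum, rfl⟩ := hx
  refine ⟨l, fun u => r u + if u = v then t else 0, c, p, fun u hu => ?_, hc, hp, hsum, ?_⟩
  · exact add_nonneg (hr u hu) (by split_ifs <;> simp [ht])
  · simp only [add_smul, Finset.sum_add_distrib, ite_smul, zero_smul, Finset.sum_ite_eq', hv,
      if_true]
    abel

theorem mem_fullGen_of_mem_closurePoints {G : GenSystem n} {v : EuclideanSpace ℝ (Fin n)}
    (hv : v ∈ G.closurePoints) : v ∈ G.fullGen := by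
  classical
  exact mem_fullGen_iff.2 ⟨0, 0, fun u => if u = v then 1 else 0, 0, by simp,
    fun u _ => by dsimp only; split_ifs <;> simp, by simp, by simp [hv], by simp [hv]⟩

theorem mem_gen_of_mem_points {G : GenSystem n} {v : EuclideanSpace ℝ (Fin n)}
    (hv : v ∈ G.points) : v ∈ G.gen := by
  classical
  exact ⟨0, 0, 0, fun u => if u = v then 1 else 0, by simp, by simp,
    fun u _ => by dsimp only; split_ifs <;> simp, ⟨v, hv, by simp⟩, by simp [hv], by simp [hv]⟩

theorem add_sum_lines_mem_fullGen {G : GenSystem n} {x : EuclideanSpace ℝ (Fin n)}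
    (hx : x ∈ G.fullGen) {s : Finset (EuclideanSpace ℝ (Fin n))} (hs : s ⊆ G.lines)
    (l : EuclideanSpace ℝ (Fin n) → ℝ) : x + ∑ v ∈ s, l v • v ∈ G.fullGen := by
  classical
  induction s using Finset.induction_on with
  | empty => simpa using hx
  | insert v s hv ih =>
    rw [Finset.insert_subset_iff] at hs
    rw [Finset.sum_insert hv, add_comm (l v • v), ← add_assoc]
    exact add_smul_line_mem_fullGen (ih hs.2) hs.1 _

theorem add_sum_rays_mem_fullGen {G : GenSystem n} {x : EuclideanSpace ℝ (Fin n)}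
    (hx : x ∈ G.fullGen) {s : Finset (EuclideanSpace ℝ (Fin n))} (hs : s ⊆ G.rays)
    {r : EuclideanSpace ℝ (Fin n) → ℝ} (hr : ∀ v ∈ s, 0 ≤ r v) :
    x + ∑ v ∈ s, r v • v ∈ G.fullGen := by
  classical
  induction s using Finset.induction_on with
  | empty => simpa using hx
  | insert v s hv ih =>
    rw [Finset.insert_subset_iff] at hs
    rw [Finset.sum_insert hv, add_comm (r v • v), ← add_assoc]
    exact add_smul_ray_mem_fullGen (ih hs.2 fun u hu => hr u (Finset.mem_insert_of_mem hu)) hs.1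
      (hr v (Finset.mem_insert_self _ _))

/-- `H.fullGen` contains everything generated by points of it along lines and rays of `H`. -/
theorem fullGen_subset_fullGen {G H : GenSystem n} (hl : G.lines ⊆ H.lines)
    (hr : G.rays ⊆ H.rays) (hc : ∀ v ∈ G.closurePoints, v ∈ H.fullGen)
    (hp : ∀ v ∈ G.points, v ∈ H.fullGen) : G.fullGen ⊆ H.fullGen := by
  classical
  rintro x ⟨l, r, c, p, hr0, -, hp0, -, hsum, rfl⟩
  simp only [full, Finset.sum_empty, zero_add, add_zero] at hsum hr0 hp0 ⊢
  have hy : ∑ v ∈ G.closurePoints ∪ G.points, p v • v ∈ H.fullGen :=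
    H.convex_fullGen.sum_mem hp0 hsum fun v hv =>
      (Finset.mem_union.1 hv).elim (hc v) (hp v)
  generalize ∑ v ∈ G.closurePoints ∪ G.points, p v • v = y at hy
  rw [add_comm (∑ v ∈ _, l v • v), add_comm _ y, ← add_assoc]
  exact add_sum_lines_mem_fullGen (add_sum_rays_mem_fullGen hy hr hr0) hl l

end GenSystem

/-! ### Closure of `gen`, redundant points and the skeleton. -/

namespace GenSystem

variable {n : ℕ}

/-- In the mixed combination `p` has weight at least `t > 0`, which is all that separates `gen` from
`fullGen`. -/
theorem smul_add_smul_mem_gen {G : GenSystem n} {x p : EuclideanSpace ℝ (Fin n)}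
    (hx : x ∈ G.fullGen) (hp : p ∈ G.points) {t : ℝ} (ht : 0 < t) (ht1 : t ≤ 1) :
    (1 - t) • x + t • p ∈ G.gen := by
  classical
  obtain ⟨l, r, c, q, hr, hc, hq, hsum, rfl⟩ := mem_fullGen_iff.1 hx
  have ht' : 0 ≤ 1 - t := sub_nonneg.2 ht1
  refine ⟨fun v => (1 - t) * l v, fun v => (1 - t) * r v, fun v => (1 - t) * c v,
    fun v => (1 - t) * q v + if v = p then t else 0, fun v hv => mul_nonneg ht' (hr v hv),
    fun v hv => mul_nonneg ht' (hc v hv), fun v hv => add_nonneg (mul_nonneg ht' (hq v hv)) ?_,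
    ⟨p, hp, ?_⟩, ?_, ?_⟩
  · split_ifs <;> simp [ht.le]
  · have := mul_nonneg ht' (hq p hp)
    simp only [if_true]
    linarith
  · simp only [Finset.sum_add_distrib, ← Finset.mul_sum, Finset.sum_ite_eq', hp, if_true]
    linear_combination (1 - t) * hsum
  · simp only [add_smul, mul_smul, Finset.sum_add_distrib, ← Finset.smul_sum, ite_smul, zero_smul,
      Finset.sum_ite_eq', hp, if_true, smul_add]
    abel

theorem closure_gen {G : GenSystem n} (hG : G.points.Nonempty) : closure G.gen = G.fullGen := by
  refine (closure_minimal G.gen_subset_fullGen G.isClosed_fullGen).antisymm fun x hx => ?_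
  obtain ⟨p, hp⟩ := hG
  have hlim : Filter.Tendsto (fun t : ℝ => (1 - t) • x + t • p) (nhdsWithin 0 (Set.Ioc 0 1))
      (nhds x) := by
    have : Continuous fun t : ℝ => (1 - t) • x + t • p := by fun_prop
    simpa using (this.tendsto 0).mono_left nhdsWithin_le_nhds
  have : (nhdsWithin (0 : ℝ) (Set.Ioc 0 1)).NeBot := by
    rw [nhdsWithin_Ioc_eq_nhdsGT zero_lt_one]
    infer_instance
  exact mem_closure_of_tendsto hlim
    (eventually_mem_nhdsWithin.mono fun t ht => smul_add_smul_mem_gen hx hp ht.1 ht.2)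

/-- A point which is a combination of the other generators, one of them a point, is redundant. -/
theorem gen_erasePoint {G : GenSystem n} {p : EuclideanSpace ℝ (Fin n)}
    (hp : p ∈ G.points) (h : p ∈ (G.erasePoint p).gen) : (G.erasePoint p).gen = G.gen := by
  classical
  obtain ⟨l, r, c, q, hr, hc, hq, ⟨u, hu, hqu⟩, hsum, hpeq⟩ := h
  simp only [erasePoint] at hr hc hq hu hsum hpeq
  ext x
  constructor
  · rintro ⟨l', r', c', q', hr', hc', hq', ⟨u', hu', hqu'⟩, hsum', rfl⟩
    simp only [erasePoint] at hr' hc' hq' hu' hsum' ⊢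
    refine ⟨l', r', c', fun v => if v = p then 0 else q' v, hr', hc', fun v hv => ?_,
      ⟨u', Finset.mem_of_mem_erase hu', by simpa [Finset.ne_of_mem_erase hu'] using hqu'⟩, ?_, ?_⟩
    · dsimp only
      split_ifs with hvp
      exacts [le_rfl, hq' v (Finset.mem_erase.2 ⟨hvp, hv⟩)]
    · rw [← hsum', ← Finset.add_sum_erase _ _ hp, if_pos rfl, zero_add]
      exact congrArg _ (Finset.sum_congr rfl fun v hv => by simp [Finset.ne_of_mem_erase hv])
    · rw [← Finset.add_sum_erase _ _ hp]
      simp only [if_true, zero_smul, zero_add]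
      exact congrArg _ (Finset.sum_congr rfl fun v hv => by simp [Finset.ne_of_mem_erase hv])
  · rintro ⟨l', r', c', q', hr', hc', hq', ⟨u', hu', hqu'⟩, hsum', rfl⟩
    have h0 := hq' p hp
    have hqnn (v) (hv : v ∈ G.points.erase p) : 0 ≤ q' v := hq' v (Finset.mem_of_mem_erase hv)
    rw [← Finset.add_sum_erase _ _ hp] at hsum' ⊢
    -- The given representation of `p`, scaled by the weight `q' p`, is substituted for `p`.
    refine ⟨fun v => l' v + q' p * l v, fun v => r' v + q' p * r v, fun v => c' v + q' p * c v,
      fun v => q' v + q' p * q v, fun v hv => add_nonneg (hr' v hv) (mul_nonneg h0 (hr v hv)),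
      fun v hv => add_nonneg (hc' v hv) (mul_nonneg h0 (hc v hv)),
      fun v hv => add_nonneg (hqnn v hv) (mul_nonneg h0 (hq v hv)), ?_, ?_, ?_⟩
    -- A point of non-zero weight survives: if `p` was not used, it is the old `u'`; otherwise it is
    -- `u` from the representation of `p`.
    · by_cases hz : q' p = 0
      · have hne : u' ≠ p := fun h => hqu' (h ▸ hz)
        exact ⟨u', Finset.mem_erase.2 ⟨hne, hu'⟩, by simpa [hz] using hqu'⟩
      · have h1 : 0 < q' p * q u :=
          mul_pos (lt_of_le_of_ne h0 (Ne.symm hz)) (lt_of_le_of_ne (hq u hu) (Ne.symm hqu))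
        exact ⟨u, hu, (add_pos_of_nonneg_of_pos (hqnn u hu) h1).ne'⟩
    · simp only [erasePoint, Finset.sum_add_distrib, ← Finset.mul_sum]
      linear_combination hsum' + q' p * hsum
    · have hpeq' := congrArg (q' p • ·) hpeq
      simp only [smul_add] at hpeq'
      rw [hpeq']
      simp only [erasePoint, Finset.sum_add_distrib, add_smul, mul_smul, ← Finset.smul_sum]
      abel

/-- A point `p` outside the skeleton is a combination of the other generators. If another point had
non-zero weight in it, `p` would be redundant, against minimality. So only lines, rays and closure
points occur, and the skeleton keeps all of these. -/
theorem mem_fullGen_skel {G : GenSystem n} (hG : G.IsMinimalForm)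
    {p : EuclideanSpace ℝ (Fin n)} (hp : p ∈ G.points) : p ∈ G.skel.fullGen := by
  classical
  by_cases hps : p ∈ G.skelPoints
  · exact mem_fullGen_of_mem_closurePoints (Finset.mem_union_right _ hps)
  have hpe : p ∈ (G.erasePoint p).fullGen := by
    simpa [skelPoints, hp] using hps
  obtain ⟨l, r, c, q, hr, hc, hq, hsum, hpeq⟩ := mem_fullGen_iff.1 hpe
  by_cases hz : ∃ v ∈ (G.erasePoint p).points, q v ≠ 0
  · have heq := hG (G.erasePoint p)
      ⟨subset_rfl, subset_rfl, subset_rfl, Finset.erase_subset _ _⟩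
      (gen_erasePoint hp ⟨l, r, c, q, hr, hc, hq, hz, hsum, hpeq⟩)
    rw [← heq] at hp
    exact absurd hp (Finset.notMem_erase _ _)
  · push Not at hz
    have hz' : ∑ v ∈ (G.erasePoint p).points, q v • v = 0 :=
      Finset.sum_eq_zero fun v hv => by rw [hz v hv, zero_smul]
    rw [Finset.sum_eq_zero hz, add_zero] at hsum
    rw [hz', add_zero] at hpeq
    let H : GenSystem n := { G with points := ∅ }
    refine fullGen_subset_fullGen (G := H) (H := G.skel) subset_rfl subset_rfl
      (fun v hv => mem_fullGen_of_mem_closurePoints (Finset.mem_union_left _ hv)) (by simp [H])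
      (mem_fullGen_iff.2 ⟨l, r, c, 0, hr, hc, by simp [H], ?_, ?_⟩)
    · simpa [H, erasePoint] using hsum
    · simpa [H, erasePoint] using hpeq

theorem fullGen_skel {G : GenSystem n} (hG : G.IsMinimalForm) : G.skel.fullGen = G.fullGen := by
  classical
  refine (fullGen_subset_fullGen (G := G.skel) (H := G) subset_rfl subset_rfl (fun v hv => ?_)
    (by simp [skel])).antisymm (fullGen_subset_fullGen (G := G) (H := G.skel) subset_rfl subset_rfl
      (fun v hv => mem_fullGen_of_mem_closurePoints (Finset.mem_union_left _ hv))
      fun v hv => mem_fullGen_skel hG hv)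
  rcases Finset.mem_union.1 hv with hv | hv
  · exact mem_fullGen_of_mem_closurePoints hv
  · exact gen_subset_fullGen _ (mem_gen_of_mem_points (Finset.mem_filter.1 hv).1)

end GenSystem

/-! ### Faces, supports and the decomposition into relative interiors. -/

namespace NNC

variable {n : ℕ}

open GenSystem

/-- Every point of a polyhedron is in the relative interior of some face. -/
theorem exists_mem_cFaces_mem_intrinsicInterior {G : GenSystem n} {x : EuclideanSpace ℝ (Fin n)}
    (hx : x ∈ G.fullGen) : ∃ F ∈ cFaces G.fullGen, x ∈ intrinsicInterior ℝ F := by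
  classical
  obtain ⟨T, hT, h⟩ := G.exists_fullGen_eq_halfspaces
  rw [h] at hx ⊢
  -- The sum of the tight constraints is a single valid inequality; equality in it forces equality
  -- in each summand, so it defines the face cut out by all tight constraints at once.
  let T₀ := hT.toFinset.filter fun f => inner ℝ f.1 x = f.2
  have hle (y) (hy : ∀ f ∈ T, f.2 ≤ inner ℝ f.1 y) : ∀ f ∈ T₀, f.2 ≤ inner ℝ f.1 y := fun f hf =>
    hy f (hT.mem_toFinset.1 (Finset.mem_filter.1 hf).1)
  refine ⟨_, ⟨∑ f ∈ T₀, f.1, ∑ f ∈ T₀, f.2, fun y hy => ?_, rfl⟩, ?_⟩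
  · rw [sum_inner]
    exact Finset.sum_le_sum (hle y hy)
  · refine (Set.ext_iff.1 (congrArg (intrinsicInterior ℝ) (Set.ext fun y => ?_)) x).2
      (mem_intrinsicInterior_tight hT hx)
    refine and_congr_right fun hy => ?_
    rw [sum_inner, eq_comm, Finset.sum_eq_sum_iff_of_le (hle y hy)]
    simp only [T₀, Finset.mem_filter, hT.mem_toFinset, and_imp]
    exact forall₃_congr fun f _ _ => eq_comm

/-- The functional defining `F` vanishes on lines, is non-negative on rays and is at least `b` on
closure points. A combination attaining the minimum `b` can therefore put weight only on rays where
it is 0 and closure points where it is `b`, which are those of the support. -/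
theorem fullGen_support {SK : GenSystem n} (hSK : SK.points = ∅)
    {F : Set (EuclideanSpace ℝ (Fin n))} (hF : F ∈ cFaces SK.fullGen) :
    (support SK F).fullGen = F := by
  classical
  obtain ⟨a, b, hab, hFeq⟩ := hF
  have hlines : ∀ y ∈ SK.fullGen, ∀ v ∈ SK.lines, inner ℝ a v = 0 := by
    intro y hy v hv
    by_contra hne
    -- The multiple of `v` is chosen so that the functional takes the value `b - 1`, violating the
    -- constraint; rays are treated likewise below.
    have := hab _ (add_smul_line_mem_fullGen hy hv ((b - 1 - inner ℝ a y) / inner ℝ a v))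
    rw [inner_add_right, inner_smul_right, div_mul_cancel₀ _ hne] at this
    linarith
  have hrays : ∀ y ∈ SK.fullGen, ∀ v ∈ SK.rays, 0 ≤ inner ℝ a v := by
    intro y hy v hv
    by_contra! hneg
    have hy0 := hab y hy
    have := hab _ (add_smul_ray_mem_fullGen hy hv
      (div_nonneg_of_nonpos (b := inner ℝ a v) (a := b - 1 - inner ℝ a y) (by linarith) hneg.le))
    rw [inner_add_right, inner_smul_right, div_mul_cancel₀ _ hneg.ne] at this
    linarith
  ext x
  rw [mem_fullGen_iff]
  constructor
  · rintro ⟨l, r, c, q, hr, hc, hq, hsum, hx⟩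
    have hxQ : x ∈ SK.fullGen := by
      refine fullGen_subset_fullGen (G := support SK F) (Finset.filter_subset _ _)
        (Finset.filter_subset _ _) (fun v hv => mem_fullGen_of_mem_closurePoints
          (Finset.mem_filter.1 hv).1) (by simp [support])
        (mem_fullGen_iff.2 ⟨l, r, c, q, hr, hc, hq, hsum, hx⟩)
    rw [hFeq]
    refine ⟨hxQ, ?_⟩
    simp only [support, Finset.sum_empty, add_zero] at hx hsum
    rw [hx]
    simp only [inner_add_right, inner_sum, inner_smul_right]
    rw [Finset.sum_eq_zero, Finset.sum_eq_zero, zero_add, zero_add]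
    · rw [← one_mul b, ← hsum, Finset.sum_mul]
      refine Finset.sum_congr rfl fun v hv => ?_
      have := (Finset.mem_filter.1 hv).2
      rw [hFeq] at this
      rw [this.2]
    · intro v hv
      obtain ⟨⟨p, hp⟩, -, h⟩ := (Finset.mem_filter.1 hv).2
      have h1 := h p hp 1 zero_le_one
      rw [hFeq] at h1 hp
      have h2 := h1.2
      rw [one_smul, inner_add_right, hp.2] at h2
      rw [left_eq_add.1 h2.symm, mul_zero]
    · intro v hv
      rw [hlines x hxQ v (Finset.mem_filter.1 hv).1, mul_zero]
  · intro hxF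
    have hxF' := hxF
    rw [hFeq] at hxF'
    obtain ⟨hxQ, hxb⟩ := hxF'
    have hrayF : ∀ v ∈ SK.rays, inner ℝ a v = 0 → IsRay F v := by
      refine fun v hv h0 => ⟨⟨x, hxF⟩, fun h => SK.zero_notMem_rays (h ▸ hv), fun p hp t ht => ?_⟩
      rw [hFeq] at hp ⊢
      exact ⟨add_smul_ray_mem_fullGen hp.1 hv ht, by
        rw [inner_add_right, inner_smul_right, h0, mul_zero, add_zero, hp.2]⟩
    have hlineF : ∀ v ∈ SK.lines, IsLine F v := by
      have key (v) (hv : v ∈ SK.lines) (p) (hp : p ∈ F) (t : ℝ) : p + t • v ∈ F := by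
        rw [hFeq] at hp ⊢
        exact ⟨add_smul_line_mem_fullGen hp.1 hv t, by
          rw [inner_add_right, inner_smul_right, hlines p hp.1 v hv, mul_zero, add_zero, hp.2]⟩
      intro v hv
      have hv0 : v ≠ 0 := fun h => SK.zero_notMem_lines (h ▸ hv)
      exact ⟨⟨⟨x, hxF⟩, hv0, fun p hp t _ => key v hv p hp t⟩, ⟨x, hxF⟩, neg_ne_zero.2 hv0,
        fun p hp t _ => by simpa using key v hv p hp (-t)⟩
    obtain ⟨l, r, c, q, hr, hc, hq, hsum, hx⟩ := mem_fullGen_iff.1 hxQ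
    simp only [hSK, Finset.sum_empty, add_zero] at hsum hx
    -- The excess of the functional over `b` at `x` is a sum of these non-negative contributions and
    -- equals 0, so each contribution vanishes.
    have hcQ : ∀ v ∈ SK.closurePoints, 0 ≤ c v * (inner ℝ a v - b) := fun v hv =>
      mul_nonneg (hc v hv) (sub_nonneg.2 (hab v (mem_fullGen_of_mem_closurePoints hv)))
    have hrQ : ∀ v ∈ SK.rays, 0 ≤ r v * inner ℝ a v := fun v hv =>
      mul_nonneg (hr v hv) (hrays x hxQ v hv)
    have htotal : ∑ v ∈ SK.rays, r v * inner ℝ a v +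
        ∑ v ∈ SK.closurePoints, c v * (inner ℝ a v - b) = 0 := by
      have hxb' := hxb
      rw [hx] at hxb'
      simp only [inner_add_right, inner_sum, inner_smul_right] at hxb'
      rw [Finset.sum_eq_zero fun v hv => by rw [hlines x hxQ v hv, mul_zero], zero_add] at hxb'
      simp only [mul_sub, Finset.sum_sub_distrib, ← Finset.sum_mul, hsum]
      linarith
    rw [add_eq_zero_iff_of_nonneg (Finset.sum_nonneg hrQ) (Finset.sum_nonneg hcQ),
      Finset.sum_eq_zero_iff_of_nonneg hrQ, Finset.sum_eq_zero_iff_of_nonneg hcQ] at htotal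
    have hc0 : ∀ v ∈ SK.closurePoints, c v ≠ 0 → v ∈ F := by
      intro v hv hne
      rw [hFeq]
      exact ⟨mem_fullGen_of_mem_closurePoints hv,
        sub_eq_zero.1 ((mul_eq_zero.1 (htotal.2 v hv)).resolve_left hne)⟩
    have hr0 : ∀ v ∈ SK.rays, r v ≠ 0 → IsRay F v := fun v hv hne =>
      hrayF v hv ((mul_eq_zero.1 (htotal.1 v hv)).resolve_left hne)
    refine ⟨l, r, c, 0, fun v hv => hr v (Finset.mem_filter.1 hv).1,
      fun v hv => hc v (Finset.mem_filter.1 hv).1, by simp, ?_, ?_⟩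
    · simp only [support, Finset.sum_empty, add_zero]
      rw [Finset.sum_filter_of_ne hc0, hsum]
    · simp only [support, Finset.sum_empty, add_zero]
      rw [Finset.filter_true_of_mem hlineF,
        Finset.sum_filter_of_ne fun v hv hne => hr0 v hv (left_ne_zero_of_smul hne),
        Finset.sum_filter_of_ne fun v hv hne => hc0 v hv (left_ne_zero_of_smul hne), hx]

/-- The functional defining `F` is constant on `F`, hence on `F'`, so it vanishes on every ray of
`F'`. A ray of `F'` that moreover preserves `SK.fullGen` is then a ray of all of `F`. -/
theorem support_mono {SK : GenSystem n} {F F' : Set (EuclideanSpace ℝ (Fin n))}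
    (hF : F ∈ cFaces SK.fullGen) (hFF' : F' ⊆ F) :
    support SK F' ⊆ support SK F := by
  classical
  obtain ⟨a, b, -, hFeq⟩ := hF
  have hF (y) (hy : y ∈ F) : y ∈ SK.fullGen ∧ inner ℝ a y = b := by rwa [hFeq] at hy
  have key {v} (hv : IsRay F' v) (hQ : ∀ p ∈ SK.fullGen, ∀ t : ℝ, 0 ≤ t → p + t • v ∈ SK.fullGen) :
      IsRay F v := by
    obtain ⟨⟨p, hp⟩, hv0, h⟩ := hv
    have h1 := (hF _ (hFF' (h p hp 1 zero_le_one))).2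
    rw [one_smul, inner_add_right, (hF _ (hFF' hp)).2, add_eq_left] at h1
    refine ⟨⟨p, hFF' hp⟩, hv0, fun y hy t ht => ?_⟩
    obtain ⟨hyQ, hyb⟩ := hF y hy
    rw [hFeq]
    exact ⟨hQ y hyQ t ht, by rw [inner_add_right, inner_smul_right, h1, mul_zero, add_zero, hyb]⟩
  refine ⟨fun v hv => ?_, fun v hv => ?_, fun v hv => ?_, subset_rfl⟩
  · obtain ⟨hv, h1, h2⟩ := Finset.mem_filter.1 hv
    exact Finset.mem_filter.2 ⟨hv, key h1 fun p hp t _ => add_smul_line_mem_fullGen hp hv t,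
      key h2 fun p hp t _ => by simpa using add_smul_line_mem_fullGen hp hv (-t)⟩
  · obtain ⟨hv, h1⟩ := Finset.mem_filter.1 hv
    exact Finset.mem_filter.2 ⟨hv, key h1 fun p hp t ht => add_smul_ray_mem_fullGen hp hv ht⟩
  · obtain ⟨hv, h1⟩ := Finset.mem_filter.1 hv
    exact Finset.mem_filter.2 ⟨hv, hFF' h1⟩

theorem fullGen_mono {G H : GenSystem n} (h : G ⊆ H) : G.fullGen ⊆ H.fullGen :=
  fullGen_subset_fullGen h.1 h.2.1 (fun _ hv => mem_fullGen_of_mem_closurePoints (h.2.2.1 hv))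
    fun _ hv => gen_subset_fullGen _ (mem_gen_of_mem_points (h.2.2.2 hv))

/-- From `y ∈ F'` the segment to `p` extends beyond `p` inside `F'`. The functional defining `F`
attains its minimum at the inner point `p` of this segment, so it is constant along it. -/
theorem subset_of_mem_intrinsicInterior {Q F F' : Set (EuclideanSpace ℝ (Fin n))}
    (hF : F ∈ cFaces Q) (hF' : F' ∈ cFaces Q) {p : EuclideanSpace ℝ (Fin n)}
    (hp : p ∈ intrinsicInterior ℝ F') (hpF : p ∈ F) : F' ⊆ F := by
  obtain ⟨a, b, hab, rfl⟩ := hF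
  obtain ⟨a', b', -, rfl⟩ := hF'
  refine fun y hy => ⟨hy.1, ?_⟩
  obtain ⟨ε, hε, h⟩ := exists_pos_add_smul_sub_mem_of_mem_intrinsicInterior hp hy
  have h1 := hab _ h.1
  have h2 := hab y hy.1
  rw [inner_add_right, inner_smul_right, inner_sub_right, hpF.2] at h1
  nlinarith

/-- Every element of `G.gen` uses a point of `G`, which lies in all faces containing the element. -/
theorem exists_mem_points_of_mem_gen {G : GenSystem n} {x : EuclideanSpace ℝ (Fin n)}
    (hx : x ∈ G.gen) : ∃ p ∈ G.points, ∀ F ∈ cFaces G.fullGen, x ∈ F → p ∈ F := by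
  classical
  obtain ⟨l, r, c, q, hr, hc, hq, ⟨p, hp, hqp⟩, hsum, hx⟩ := hx
  have hpQ := gen_subset_fullGen _ (mem_gen_of_mem_points hp)
  refine ⟨p, hp, ?_⟩
  rintro _ ⟨a, b, hab, rfl⟩ ⟨hxQ, hxb⟩
  -- moving from `x` slightly away from `p` stays in the polyhedron
  have hq0 : 0 < q p := lt_of_le_of_ne (hq p hp) (Ne.symm hqp)
  have hy : x + q p • (x - p) ∈ G.fullGen := by
    rw [mem_fullGen_iff]
    have h1 : 0 ≤ 1 + q p := by linarith
    refine ⟨fun v => (1 + q p) * l v, fun v => (1 + q p) * r v, fun v => (1 + q p) * c v,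
      fun v => (1 + q p) * q v - if v = p then q p else 0, fun v hv => mul_nonneg h1 (hr v hv),
      fun v hv => mul_nonneg h1 (hc v hv), fun v hv => ?_, ?_, ?_⟩
    · dsimp only
      have := hq v hv
      split_ifs with h
      · subst h
        nlinarith
      · simpa using mul_nonneg h1 this
    · simp only [Finset.sum_sub_distrib, ← Finset.mul_sum, Finset.sum_ite_eq', hp, if_true]
      linear_combination (1 + q p) * hsum
    · simp only [sub_smul, mul_smul, Finset.sum_sub_distrib, ← Finset.smul_sum, ite_smul,
        zero_smul, Finset.sum_ite_eq', hp, if_true]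
      rw [smul_sub, ← add_sub_assoc, ← add_sub_assoc, ← smul_add, ← smul_add, ← smul_add, ← hx,
        add_smul, one_smul]
  refine ⟨hpQ, ?_⟩
  have h1 := hab _ hy
  have h2 := hab p hpQ
  rw [inner_add_right, inner_smul_right, inner_sub_right, hxb] at h1
  nlinarith

/-- The inclusion of supports is used as a restatement of `p ∈ F`. Only equality of the `fullGen`
matters, so `SK` need not come from `G` itself. -/
theorem gen_eq_iUnion_intrinsicInterior {G SK : GenSystem n} (hSK : SK.points = ∅)
    (hQ : SK.fullGen = G.fullGen) :
    G.gen = ⋃ F ∈ {F | F ∈ cFaces SK.fullGen ∧ ∃ p ∈ G.points, ∃ F' ∈ cFaces SK.fullGen,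
      p ∈ intrinsicInterior ℝ F' ∧ support SK F' ⊆ support SK F}, intrinsicInterior ℝ F := by
  ext x
  simp only [Set.mem_iUnion, Set.mem_ofPred_eq, exists_prop]
  constructor
  · intro hx
    obtain ⟨F, hF, hxF⟩ := exists_mem_cFaces_mem_intrinsicInterior
      (hQ ▸ gen_subset_fullGen _ hx : x ∈ SK.fullGen)
    obtain ⟨p, hp, hpF⟩ := exists_mem_points_of_mem_gen hx
    obtain ⟨F', hF', hpF'⟩ := exists_mem_cFaces_mem_intrinsicInterior
      (hQ ▸ gen_subset_fullGen _ (mem_gen_of_mem_points hp) : p ∈ SK.fullGen)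
    exact ⟨F, ⟨hF, p, hp, F', hF', hpF', support_mono hF (subset_of_mem_intrinsicInterior hF hF'
      hpF' (hpF F (hQ ▸ hF) (intrinsicInterior_subset hxF)))⟩, hxF⟩
  · rintro ⟨F, ⟨hF, p, hp, F', hF', hpF', hsub⟩, hxF⟩
    have hpF : p ∈ F := by
      rw [← fullGen_support hSK hF]
      refine fullGen_mono hsub ?_
      rw [fullGen_support hSK hF']
      exact intrinsicInterior_subset hpF'
    obtain ⟨ε, hε, h⟩ := exists_pos_add_smul_sub_mem_of_mem_intrinsicInterior hxF hpF
    obtain ⟨a, b, -, rfl⟩ := hF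
    have hy : x + ε • (x - p) ∈ G.fullGen := hQ ▸ h.1
    have h1 : (0 : ℝ) < 1 + ε := by linarith
    -- With `y = x + ε • (x - p)`, the value `t = ε / (1 + ε)` is the solution of `x = (1 - t) • y +
    -- t • p`.
    have hmem := smul_add_smul_mem_gen hy hp (t := ε / (1 + ε)) (by positivity)
      (by rw [div_le_one h1]; linarith)
    convert hmem using 1
    have h2 : 1 - ε / (1 + ε) = (1 + ε)⁻¹ := by field_simp; ring
    rw [h2]
    have h3 : (1 + ε) • x = (1 + ε) • ((1 + ε)⁻¹ • (x + ε • (x - p)) + (ε / (1 + ε)) • p) := by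
      rw [smul_add, smul_inv_smul₀ h1.ne', smul_smul, mul_div_cancel₀ _ h1.ne']
      module
    exact smul_right_injective _ h1.ne' h3

/-- Each member of the abstraction is the support of a face `F`, and its `fullGen` is `F` again by
`fullGen_support`. -/
theorem gamma_alpha {SK : GenSystem n} (hSK : SK.points = ∅)
    (S : Set (EuclideanSpace ℝ (Fin n))) :
    gamma (alpha SK SK.fullGen S) =
      ⋃ F ∈ {F | F ∈ cFaces SK.fullGen ∧ ∃ p ∈ S, ∃ F' ∈ cFaces SK.fullGen,
        p ∈ intrinsicInterior ℝ F' ∧ support SK F' ⊆ support SK F}, intrinsicInterior ℝ F := by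
  ext x
  simp only [gamma, alpha, Set.mem_iUnion, Set.mem_ofPred_eq, exists_prop, Set.mem_sUnion]
  constructor
  · rintro ⟨_, ⟨_, ⟨p, hp, F', hF', hpF', rfl⟩, ⟨F, hF, rfl⟩, hsub⟩, hx⟩
    rw [fullGen_support hSK hF] at hx
    exact ⟨F, ⟨hF, p, hp, F', hF', hpF', hsub⟩, hx⟩
  · rintro ⟨F, ⟨hF, p, hp, F', hF', hpF', hsub⟩, hx⟩
    exact ⟨_, ⟨_, ⟨p, hp, F', hF', hpF', rfl⟩, ⟨F, hF, rfl⟩, hsub⟩,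
      by rwa [fullGen_support hSK hF]⟩

end NNC

/-! ### The proposition. -/

theorem mainTheorem1 (n : ℕ) (G Gm : GenSystem n)
    (hmin : Gm.IsMinimalForm) (hgen : Gm.gen = G.gen) :
    G.gen = NNC.gamma (NNC.alpha Gm.skel (closure G.gen) (G.points : Set _)) ∧
    G.gen = ⋃ F ∈ {F | F ∈ NNC.cFaces (closure G.gen) ∧
        ∃ p ∈ G.points, ∃ F' ∈ NNC.cFaces (closure G.gen),
          p ∈ intrinsicInterior ℝ F' ∧
          NNC.support Gm.skel F' ⊆ NNC.support Gm.skel F},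
      intrinsicInterior ℝ F := by
  rcases G.points.eq_empty_or_nonempty with hG | hG
  -- Without points every set involved is empty. This case is separate because `closure_gen` needs a
  -- point: closure points alone can make `fullGen` non-empty while `gen` is empty.
  · simp [GenSystem.gen_eq_empty hG, hG, NNC.gamma, NNC.alpha]
  · have hGm : Gm.points.Nonempty := by
      by_contra h
      obtain ⟨p, hp⟩ := hG
      have := GenSystem.mem_gen_of_mem_points hp
      rw [← hgen, GenSystem.gen_eq_empty (Finset.not_nonempty_iff_eq_empty.1 h)] at this
      exact this
    have hQ : Gm.skel.fullGen = closure G.gen := by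
      rw [GenSystem.fullGen_skel hmin, ← hgen, GenSystem.closure_gen hGm]
    have hSK : Gm.skel.points = ∅ := rfl
    -- The skeleton comes from `Gm` and the points from `G`; the link is that both `fullGen` equal
    -- the common closure.
    have hunion := NNC.gen_eq_iUnion_intrinsicInterior hSK (hQ.trans (GenSystem.closure_gen hG))
    rw [← hQ]
    refine ⟨?_, hunion⟩
    rw [NNC.gamma_alpha hSK]
    exact hunion
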